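/- Let $0\le k\le n$ be integers. Let $\mathcal S(\mathbb R^m)$ be the Schwartz space of complex-valued functions on $\mathbb R^m$, and let $\mathcal S'(\mathbb R^m)$ be the space of tempered distributions, i.e. continuous $\mathbb C$-linear functionals $\mathcal S(\mathbb R^m)\to\mathbb C$. For $g_1\in\mathcal S'(\mathbb R^k)$ and $g_2\in\mathcal S'(\mathbb R^{n-k})$ let $g_1\otimes g_2\in\mathcal S'(\mathbb R^n)$ be their tensor product, the unique distribution with $\langle g_1\otimes g_2,\phi_1\otimes\phi_2\rangle=\langle g_1,\phi_1\rangle\langle g_2,\phi_2\rangle$ for all $\phi_1\in\mathcal S(\mathbb R^k)$, $\phi_2\in\mathcal S(\mathbb R^{n-k})$, where $(\phi_1\otimes\phi_2)(\mathbf x,\mathbf y)=\phi_1(\mathbf x)\phi_2(\mathbf y)$. Let $\delta^{n-k}$ be the Dirac delta at the origin of $\mathbb R^{n-k}$. For an orthogonal matrix $U\in\mathbb R^{n\times n}$ and $g\in\mathcal S'(\mathbb R^n)$ define $g_U\in\mathcal S'(\mathbb R^n)$ by $\langle g_U,\phi\rangle=\langle g,\phi(U^T\,\cdot)\rangle$.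 Put $$\mathcal G'_k=\{(f\otimes\delta^{n-k})_U \mid f\in\mathcal S'(\mathbb R^k),\ U\in\mathbb R^{n\times n},\ U^TU=I_n\}.$$ For $T\in\mathcal S'(\mathbb R^n)$ let $x_iT$ be the product of $T$ with the $i$-th coordinate function, $\langle x_iT,\phi\rangle=\langle T,x_i\phi\rangle$. Then for every $T\in\mathcal S'(\mathbb R^n)$, $$T\in\mathcal G'_k\iff \dim_{\mathbb R}\operatorname{span}_{\mathbb R}\{x_1T,\dots,x_nT\}\le k .$$ -/

import Mathlib

open SchwartzMap LineDeriv
open scoped ContDiff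


noncomputable section

namespace TensorDistribution

variable {V E F : Type*} [NormedAddCommGroup V] [NormedSpace ℝ V]
  [NormedAddCommGroup E] [NormedSpace ℝ E] [NormedAddCommGroup F] [NormedSpace ℝ F]

theorem hasTemperateGrowth_prodMk (x : E) : (fun y : F => (x, y)).HasTemperateGrowth := by
  have h := (ContinuousLinearMap.inr ℝ E F).hasTemperateGrowth.add
    (Function.HasTemperateGrowth.const (x, (0 : F)))
  convert h using 1
  ext y <;> simp

/-- The function `y ↦ φ(x, y)` for fixed `x`. -/
def slice (x : E) : 𝓢(E × F, ℂ) →L[ℂ] 𝓢(F, ℂ) :=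
  compCLMOfAntilipschitz (K := 1) ℂ (g := fun y : F => (x, y)) (hasTemperateGrowth_prodMk x)
    (AntilipschitzWith.of_le_mul_dist fun y z => by simp [Prod.dist_eq])

theorem slice_apply (x : E) (φ : 𝓢(E × F, ℂ)) (y : F) : slice x φ y = φ (x, y) := rfl

theorem norm_iteratedFDeriv_slice_le (x : E) (φ : 𝓢(E × F, ℂ)) (q : ℕ) (y : F) :
    ‖iteratedFDeriv ℝ q (slice x φ) y‖ ≤ ‖iteratedFDeriv ℝ q φ (x, y)‖ := by
  have h : (slice x φ : F → ℂ) =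
      (fun w : E × F => φ ((x, 0) + w)) ∘ (ContinuousLinearMap.inr ℝ E F) := by
    ext z; simp [slice_apply]
  have hs : ContDiff ℝ ∞ (fun w : E × F => φ ((x, 0) + w)) :=
    (φ.smooth ⊤).comp (contDiff_const.add contDiff_id)
  rw [h, ContinuousLinearMap.iteratedFDeriv_comp_right _ hs y (i := q) (mod_cast le_top),
    iteratedFDeriv_comp_add_left]
  refine (ContinuousMultilinearMap.norm_compContinuousLinearMap_le _ _).trans ?_
  have h1 : ∏ _i : Fin q, ‖ContinuousLinearMap.inr ℝ E F‖ ≤ 1 :=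
    Finset.prod_le_one (fun _ _ => norm_nonneg _) fun _ _ =>
      ContinuousLinearMap.opNorm_le_bound _ zero_le_one fun z => by simp
  simpa using mul_le_mul_of_nonneg_left h1 (norm_nonneg (iteratedFDeriv ℝ q φ (x, y)))

theorem pow_mul_seminorm_slice_le (φ : 𝓢(E × F, ℂ)) (k p q : ℕ) (x : E) :
    ‖x‖ ^ k * SchwartzMap.seminorm ℂ p q (slice x φ) ≤
      SchwartzMap.seminorm ℂ (k + p) q φ := by
  have hx : ‖x‖ ^ k * SchwartzMap.seminorm ℂ p q (slice x φ) =
      SchwartzMap.seminorm ℂ p q ((((‖x‖ ^ k : ℝ)) : ℂ) • slice x φ) := by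
    rw [map_smul_eq_mul]; simp
  rw [hx]
  refine SchwartzMap.seminorm_le_bound ℂ p q _ (apply_nonneg _ _) fun y => ?_
  have h2 : ‖iteratedFDeriv ℝ q ((((‖x‖ ^ k : ℝ)) : ℂ) • slice x φ) y‖ =
      ‖x‖ ^ k * ‖iteratedFDeriv ℝ q (slice x φ) y‖ := by
    rw [FunLike.coe_smul, iteratedFDeriv_const_smul_apply ((slice x φ).contDiffAt q), norm_smul]
    simp
  rw [h2]
  have hx' : ‖x‖ ≤ ‖(x, y)‖ := norm_fst_le (x, y)
  have hy' : ‖y‖ ≤ ‖(x, y)‖ := norm_snd_le (x, y)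
  calc ‖y‖ ^ p * (‖x‖ ^ k * ‖iteratedFDeriv ℝ q (slice x φ) y‖)
      ≤ ‖(x, y)‖ ^ p * (‖(x, y)‖ ^ k * ‖iteratedFDeriv ℝ q φ (x, y)‖) := by
        gcongr
        exact norm_iteratedFDeriv_slice_le x φ q y
    _ = ‖(x, y)‖ ^ (k + p) * ‖iteratedFDeriv ℝ q φ (x, y)‖ := by ring
    _ ≤ _ := φ.le_seminorm ℂ _ _ _

theorem norm_iteratedFDeriv_lineDeriv_le (φ : 𝓢(V, ℂ)) (v : V) (q : ℕ) (z : V) :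
    ‖iteratedFDeriv ℝ q (∂_{v} φ : 𝓢(V, ℂ)) z‖ ≤ ‖v‖ * ‖iteratedFDeriv ℝ (q + 1) φ z‖ := by
  have h : ((∂_{v} φ : 𝓢(V, ℂ)) : V → ℂ) =
      (ContinuousLinearMap.apply ℝ ℂ v) ∘ (fderiv ℝ φ) := by
    ext w; rfl
  have hs : ContDiff ℝ ∞ (fderiv ℝ φ) := (fderivCLM ℝ V ℂ φ).smooth ⊤
  rw [h]
  refine (ContinuousLinearMap.norm_iteratedFDeriv_comp_left _ (N := ∞) hs.contDiffAt
    (mod_cast le_top)).trans ?_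
  rw [norm_iteratedFDeriv_fderiv]
  gcongr
  exact ContinuousLinearMap.opNorm_le_bound _ (norm_nonneg _) fun L => by
    simpa [mul_comm] using L.le_opNorm v

theorem seminorm_lineDeriv_le (φ : 𝓢(V, ℂ)) (v : V) (p q : ℕ) :
    SchwartzMap.seminorm ℂ p q (∂_{v} φ : 𝓢(V, ℂ)) ≤
      ‖v‖ * SchwartzMap.seminorm ℂ p (q + 1) φ := by
  refine SchwartzMap.seminorm_le_bound ℂ p q _ (by positivity) fun z => ?_
  calc _ ≤ ‖z‖ ^ p * (‖v‖ * ‖iteratedFDeriv ℝ (q + 1) φ z‖) := by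
        gcongr; exact norm_iteratedFDeriv_lineDeriv_le φ v q z
    _ = ‖v‖ * (‖z‖ ^ p * ‖iteratedFDeriv ℝ (q + 1) φ z‖) := by ring
    _ ≤ _ := by gcongr; exact φ.le_seminorm ℂ _ _ _

theorem seminorm_iteratedLineDeriv_le (φ : 𝓢(V, ℂ)) (p q n : ℕ) (m : Fin n → V) :
    SchwartzMap.seminorm ℂ p q (∂^{m} φ : 𝓢(V, ℂ)) ≤
      (∏ i, ‖m i‖) * SchwartzMap.seminorm ℂ p (q + n) φ := by
  induction n generalizing q with
  | zero => simp
  | succ n ih =>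
    rw [iteratedLineDerivOp_succ_left, Fin.prod_univ_succ]
    refine (seminorm_lineDeriv_le _ _ _ _).trans ?_
    rw [mul_assoc, show q + (n + 1) = (q + 1) + n by ring]
    gcongr
    exact ih _ _

theorem lineDeriv_comm (φ : 𝓢(V, ℂ)) (v w : V) :
    (∂_{v} (∂_{w} φ : 𝓢(V, ℂ)) : 𝓢(V, ℂ)) = ∂_{w} (∂_{v} φ : 𝓢(V, ℂ)) := by
  have key : ∀ (a b : V) (z : V), (∂_{a} (∂_{b} φ : 𝓢(V, ℂ)) : 𝓢(V, ℂ)) z =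
      fderiv ℝ (fderiv ℝ φ) z a b := by
    intro a b z
    rw [lineDerivOp_apply_eq_fderiv]
    have h : ((∂_{b} φ : 𝓢(V, ℂ)) : V → ℂ) = fun w => fderiv ℝ φ w b := rfl
    have hd : DifferentiableAt ℝ (fderiv ℝ φ) z := (fderivCLM ℝ V ℂ φ).differentiableAt
    rw [h, fderiv_clm_apply hd (differentiableAt_const b)]
    simp
  ext z
  rw [key, key]
  have : IsSymmSndFDerivAt ℝ φ z :=
    (φ.contDiffAt (2 : ℕ)).isSymmSndFDerivAt (by simp)
  exact this v w

theorem iteratedLineDeriv_lineDeriv_comm (φ : 𝓢(V, ℂ)) (v : V) (n : ℕ) (m : Fin n → V) :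
    (∂^{m} (∂_{v} φ : 𝓢(V, ℂ)) : 𝓢(V, ℂ)) = ∂_{v} (∂^{m} φ : 𝓢(V, ℂ)) := by
  induction n with
  | zero => simp
  | succ n ih =>
    rw [iteratedLineDerivOp_succ_left, iteratedLineDerivOp_succ_left, ih, lineDeriv_comm]

theorem iteratedFDeriv_lineDeriv (φ : 𝓢(V, ℂ)) (v : V) (q : ℕ) (z : V) :
    iteratedFDeriv ℝ q (∂_{v} φ : 𝓢(V, ℂ)) z = fderiv ℝ (iteratedFDeriv ℝ q φ) z v := by
  ext m
  rw [← iteratedLineDerivOp_eq_iteratedFDeriv, iteratedLineDeriv_lineDeriv_comm,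
    lineDerivOp_apply_eq_fderiv, ← fderiv_continuousMultilinear_apply_const_apply]
  · simp only [← iteratedLineDerivOp_eq_iteratedFDeriv]
  · exact (φ.smooth ⊤).differentiable_iteratedFDeriv (mod_cast ENat.natCast_lt_top q) z

/-- The first-order Taylor remainder `z ↦ φ(z + v) - φ(z) - ∂_v φ(z)`. -/
def rem (φ : 𝓢(V, ℂ)) (v : V) : 𝓢(V, ℂ) := compSubConstCLM ℂ (-v) φ - φ - ∂_{v} φ

theorem rem_apply (φ : 𝓢(V, ℂ)) (v z : V) : rem φ v z = φ (z + v) - φ z - fderiv ℝ φ z v := by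
  simp [rem, lineDerivOp_apply_eq_fderiv]

theorem norm_iteratedFDeriv_rem_le (φ : 𝓢(V, ℂ)) (v z : V) (q : ℕ) (M : ℝ)
    (hM : ∀ w ∈ segment ℝ z (z + v), ‖iteratedFDeriv ℝ (q + 2) φ w‖ ≤ M) :
    ‖iteratedFDeriv ℝ q (rem φ v) z‖ ≤ M * ‖v‖ * ‖v‖ := by
  have hdiff : ∀ r : ℕ, Differentiable ℝ (iteratedFDeriv ℝ r φ) := fun r =>
    (φ.smooth ⊤).differentiable_iteratedFDeriv (mod_cast ENat.natCast_lt_top r)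
  have h1 : iteratedFDeriv ℝ q (rem φ v) z = iteratedFDeriv ℝ q φ (z + v) -
      iteratedFDeriv ℝ q φ z - fderiv ℝ (iteratedFDeriv ℝ q φ) z v := by
    have e : (rem φ v : V → ℂ) = ((fun w => φ (w + v)) - φ) - (∂_{v} φ : 𝓢(V, ℂ)) := by
      ext w; simp [rem]
    have c1 : ContDiffAt ℝ q (fun w => φ (w + v)) z :=
      ((φ.smooth q).comp (contDiff_id.add contDiff_const)).contDiffAt
    have c2 : ContDiffAt ℝ q ((fun w => φ (w + v)) - (⇑φ)) z := c1.sub (φ.contDiffAt q)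
    rw [e, iteratedFDeriv_sub_apply c2 ((∂_{v} φ : 𝓢(V, ℂ)).contDiffAt q),
      iteratedFDeriv_sub_apply c1 (φ.contDiffAt q), iteratedFDeriv_comp_add_right,
      iteratedFDeriv_lineDeriv]
  have hconv := convex_segment (𝕜 := ℝ) z (z + v)
  have hz := left_mem_segment ℝ z (z + v)
  have hzv := right_mem_segment ℝ z (z + v)
  have hM0 : 0 ≤ M := (norm_nonneg _).trans (hM z hz)
  have h2 : ∀ w ∈ segment ℝ z (z + v),
      ‖fderiv ℝ (iteratedFDeriv ℝ q φ) w - fderiv ℝ (iteratedFDeriv ℝ q φ) z‖ ≤ M * ‖v‖ := by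
    intro w hw
    rw [fderiv_iteratedFDeriv]
    simp only [Function.comp_apply]
    rw [← LinearIsometryEquiv.map_sub, LinearIsometryEquiv.norm_map]
    refine (hconv.norm_image_sub_le_of_norm_fderiv_le (𝕜 := ℝ) (C := M)
      (fun u _ => hdiff (q + 1) u)
      (fun u hu => (norm_fderiv_iteratedFDeriv.le).trans (hM u hu)) hz hw).trans ?_
    gcongr
    have := norm_sub_le_of_mem_segment hw
    simpa using this
  have h3 := hconv.norm_image_sub_le_of_norm_fderiv_le' (𝕜 := ℝ) (fun u _ => hdiff q u) h2 hz hzv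
  rw [h1]
  simpa using h3

theorem exists_seminorm_slice_rem_le (φ : 𝓢(E × F, ℂ)) (p q : ℕ) : ∃ K : ℝ, 0 ≤ K ∧
    ∀ x h : E, SchwartzMap.seminorm ℂ p q (slice x (rem φ (h, 0))) ≤ K * (‖h‖ * ‖h‖) := by
  set K : ℝ := 2 ^ p * ((Finset.Iic (p, q + 2)).sup
    fun m => SchwartzMap.seminorm ℂ m.1 m.2) φ with hK
  have hK0 : 0 ≤ K := by positivity
  refine ⟨K, hK0, fun x h => SchwartzMap.seminorm_le_bound ℂ p q _ (by positivity) fun y => ?_⟩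
  have h1 : ‖iteratedFDeriv ℝ q (rem φ (h, (0 : F))) (x, y)‖ ≤
      K / (1 + ‖y‖) ^ p * ‖(h, (0 : F))‖ * ‖(h, (0 : F))‖ := by
    refine norm_iteratedFDeriv_rem_le φ _ _ q _ fun w hw => ?_
    have hw2 : w.2 = y := by
      obtain ⟨a, b, _, _, hab, rfl⟩ := hw
      simp [← add_smul, hab]
    rw [le_div_iff₀' (by positivity)]
    have := SchwartzMap.one_add_le_sup_seminorm_apply (𝕜 := ℂ) (m := (p, q + 2)) le_rfl le_rfl φ w
    refine le_trans ?_ this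
    gcongr
    rw [← hw2]
    exact norm_snd_le w
  have h2 : ‖(h, (0 : F))‖ = ‖h‖ := by simp [Prod.norm_def]
  rw [h2] at h1
  calc ‖y‖ ^ p * ‖iteratedFDeriv ℝ q (slice x (rem φ (h, 0))) y‖
      ≤ (1 + ‖y‖) ^ p * (K / (1 + ‖y‖) ^ p * ‖h‖ * ‖h‖) := by
        gcongr
        · linarith
        · exact (norm_iteratedFDeriv_slice_le _ _ _ _).trans h1
    _ = K * (‖h‖ * ‖h‖) := by
        have : (1 + ‖y‖) ^ p ≠ 0 := by positivity
        field_simp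

theorem exists_norm_le (g : 𝓢'(F, ℂ)) : ∃ (s : Finset (ℕ × ℕ)) (C : ℝ), 0 ≤ C ∧
    ∀ ψ : 𝓢(F, ℂ), ‖g ψ‖ ≤ C * ∑ i ∈ s, SchwartzMap.seminorm ℂ i.1 i.2 ψ := by
  obtain ⟨s, C, -, h⟩ := Seminorm.bound_of_continuous (schwartz_withSeminorms ℂ F ℂ)
    ((normSeminorm ℂ ℂ).comp g.toLinearMap) (continuous_norm.comp g.continuous)
  refine ⟨s, C, C.2, fun ψ => ?_⟩
  refine (h ψ).trans ?_
  rw [_root_.smul_apply, NNReal.smul_def, smul_eq_mul]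
  gcongr
  have := Seminorm.finset_sup_le_sum (schwartzSeminormFamily ℂ F ℂ) s ψ
  refine this.trans (le_of_eq ?_)
  simp [schwartzSeminormFamily]

/-- The function `x ↦ ⟨g, φ(x, ·)⟩`. -/
def partialEval (g : 𝓢'(F, ℂ)) (φ : 𝓢(E × F, ℂ)) (x : E) : ℂ := g (slice x φ)

theorem slice_add_rem (φ : 𝓢(E × F, ℂ)) (x h : E) :
    slice x (rem φ (h, 0)) = slice (x + h) φ - slice x φ - slice x (∂_{(h, (0 : F))} φ) := by
  ext y
  simp [slice_apply, rem]

variable [FiniteDimensional ℝ E]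

theorem hasFDerivAt_partialEval (g : 𝓢'(F, ℂ)) (φ : 𝓢(E × F, ℂ)) (x : E) :
    ∃ L : E →L[ℝ] ℂ, HasFDerivAt (partialEval g φ) L x ∧
      ∀ h, L h = partialEval g (∂_{(h, (0 : F))} φ) x := by
  let L : E →ₗ[ℝ] ℂ :=
    { toFun := fun h => partialEval g (∂_{(h, (0 : F))} φ) x
      map_add' := fun a b => by
        have : ((a + b, 0) : E × F) = (a, 0) + (b, 0) := by simp
        simp only [partialEval]
        rw [this, lineDerivOp_left_add, map_add, map_add]
      map_smul' := fun c a => by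
        have : ((c • a, 0) : E × F) = c • (a, 0) := by simp
        have h2 : (c • (∂_{(a, (0 : F))} φ) : 𝓢(E × F, ℂ)) = (c : ℂ) • ∂_{(a, (0 : F))} φ := by
          ext z; simp
        simp only [partialEval]
        rw [this, lineDerivOp_left_smul, h2, map_smul, map_smul]
        simp }
  refine ⟨L.toContinuousLinearMap, ?_, fun h => rfl⟩
  rw [hasFDerivAt_iff_isLittleO_nhds_zero]
  obtain ⟨s, C, hC, hg⟩ := exists_norm_le g
  choose K hK0 hK using exists_seminorm_slice_rem_le (E := E) (F := F) φ
  have hO : (fun h : E => partialEval g φ (x + h) - partialEval g φ x -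
      L.toContinuousLinearMap h) =O[nhds 0] fun h => ‖h‖ * ‖h‖ := by
    refine Asymptotics.IsBigO.of_bound (C * ∑ i ∈ s, K i.1 i.2) (Filter.Eventually.of_forall ?_)
    intro h
    have e : partialEval g φ (x + h) - partialEval g φ x - L.toContinuousLinearMap h =
        g (slice x (rem φ (h, 0))) := by
      rw [slice_add_rem, map_sub, map_sub]; rfl
    rw [e]
    refine (hg _).trans ?_
    rw [norm_mul, norm_norm, mul_assoc, Finset.sum_mul]
    gcongr with i hi
    exact hK _ _ _ _
  refine hO.trans_isLittleO ?_
  have h1 : (fun h : E => ‖h‖) =o[nhds 0] (fun _ => (1 : ℝ)) := by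
    rw [Asymptotics.isLittleO_one_iff]
    simpa using (continuous_norm (E := E)).tendsto 0
  have h2 := h1.mul_isBigO (Asymptotics.isBigO_refl (fun h : E => ‖h‖) (nhds 0))
  rw [← Asymptotics.isLittleO_norm_right]
  simpa using h2

theorem fderiv_partialEval (g : 𝓢'(F, ℂ)) (φ : 𝓢(E × F, ℂ)) (x h : E) :
    fderiv ℝ (partialEval g φ) x h = partialEval g (∂_{(h, (0 : F))} φ) x := by
  obtain ⟨L, hL, hL'⟩ := hasFDerivAt_partialEval g φ x
  rw [hL.fderiv, hL']

theorem contDiff_partialEval (g : 𝓢'(F, ℂ)) (φ : 𝓢(E × F, ℂ)) :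
    ContDiff ℝ ∞ (partialEval g φ) := by
  rw [contDiff_infty]
  intro n
  induction n generalizing φ with
  | zero =>
    refine contDiff_zero.2 (continuous_iff_continuousAt.2 fun x => ?_)
    obtain ⟨L, hL, -⟩ := hasFDerivAt_partialEval g φ x
    exact hL.continuousAt
  | succ n ih =>
    push_cast
    refine contDiff_succ_iff_fderiv_apply.2 ⟨fun x => ?_, by simp, fun v => ?_⟩
    · obtain ⟨L, hL, -⟩ := hasFDerivAt_partialEval g φ x
      exact hL.differentiableAt
    · simp only [fderiv_partialEval]
      exact ih _

theorem iteratedFDeriv_partialEval (g : 𝓢'(F, ℂ)) (φ : 𝓢(E × F, ℂ)) (n : ℕ) (x : E)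
    (m : Fin n → E) : iteratedFDeriv ℝ n (partialEval g φ) x m =
      partialEval g (∂^{fun i => (m i, (0 : F))} φ) x := by
  induction n generalizing x with
  | zero => simp
  | succ n ih =>
    rw [iteratedLineDerivOp_succ_left, iteratedFDeriv_succ_apply_left,
      ← fderiv_continuousMultilinear_apply_const_apply]
    · simp only [ih, fderiv_partialEval]
      rfl
    · exact (contDiff_partialEval g φ).differentiable_iteratedFDeriv
        (mod_cast ENat.natCast_lt_top n) x

/-- The continuous linear map sending `φ` to the Schwartz function `x ↦ ⟨g, φ(x, ·)⟩`. -/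
def partialEvalCLM (g : 𝓢'(F, ℂ)) : 𝓢(E × F, ℂ) →L[ℂ] 𝓢(E, ℂ) :=
  mkCLM (partialEval g) (fun φ ψ x => by simp [partialEval])
    (fun a φ x => by simp [partialEval]) (contDiff_partialEval g) <| by
  rintro ⟨k, n⟩
  obtain ⟨s, C, hC, hg⟩ := exists_norm_le g
  refine ⟨s.image fun i => (k + i.1, i.2 + n), C * s.card, by positivity, fun φ x => ?_⟩
  set P := (s.image fun i => (k + i.1, i.2 + n)).sup (schwartzSeminormFamily ℂ (E × F) ℂ)
  have hP : ∀ i ∈ s, SchwartzMap.seminorm ℂ (k + i.1) (i.2 + n) φ ≤ P φ := fun i hi =>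
    Finset.le_sup (f := schwartzSeminormFamily ℂ (E × F) ℂ)
      (Finset.mem_image_of_mem (fun i => (k + i.1, i.2 + n)) hi) φ
  have hx : ‖x‖ ^ k * ‖iteratedFDeriv ℝ n (partialEval g φ) x‖ =
      ‖(‖x‖ ^ k) • iteratedFDeriv ℝ n (partialEval g φ) x‖ := by
    rw [norm_smul]; simp
  simp only
  rw [hx]
  refine ContinuousMultilinearMap.opNorm_le_bound (by positivity) fun m => ?_
  rw [_root_.smul_apply, iteratedFDeriv_partialEval, norm_smul]
  have h1 : ∏ i, ‖(m i, (0 : F))‖ = ∏ i, ‖m i‖ := by simp [Prod.norm_def]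
  set ψ : 𝓢(E × F, ℂ) := ∂^{fun i => (m i, (0 : F))} φ with hψ
  calc ‖‖x‖ ^ k‖ * ‖partialEval g ψ x‖
      ≤ ‖x‖ ^ k * (C * ∑ i ∈ s, SchwartzMap.seminorm ℂ i.1 i.2 (slice x ψ)) := by
        rw [norm_pow, norm_norm]
        gcongr
        exact hg _
    _ = C * ∑ i ∈ s, ‖x‖ ^ k * SchwartzMap.seminorm ℂ i.1 i.2 (slice x ψ) := by
        rw [Finset.mul_sum, Finset.mul_sum, Finset.mul_sum]
        refine Finset.sum_congr rfl fun i _ => by ring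
    _ ≤ C * ∑ _i ∈ s, (∏ j, ‖m j‖) * P φ := by
        refine mul_le_mul_of_nonneg_left (Finset.sum_le_sum fun i hi => ?_) hC
        refine (pow_mul_seminorm_slice_le ψ k i.1 i.2 x).trans ?_
        refine (seminorm_iteratedLineDeriv_le φ _ _ _ _).trans ?_
        rw [h1]
        gcongr
        exact hP i hi
    _ = C * s.card * P φ * ∏ i, ‖m i‖ := by
        rw [Finset.sum_const, nsmul_eq_mul]; ring

/-- The tensor product of two tempered distributions:
`⟨g₁ ⊗ g₂, φ⟩ = ⟨g₁, x ↦ ⟨g₂, φ(x, ·)⟩⟩`. -/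
def tensorProd (g₁ : 𝓢'(E, ℂ)) (g₂ : 𝓢'(F, ℂ)) : 𝓢'(E × F, ℂ) :=
  PointwiseConvergenceCLM.precomp ℂ (partialEvalCLM g₂) g₁

/-- The defining rule `⟨g₁ ⊗ g₂, φ₁ ⊗ φ₂⟩ = ⟨g₁, φ₁⟩ ⟨g₂, φ₂⟩`. -/
theorem tensorProd_apply_of_eq_mul (g₁ : 𝓢'(E, ℂ)) (g₂ : 𝓢'(F, ℂ)) (φ₁ : 𝓢(E, ℂ)) (φ₂ : 𝓢(F, ℂ))
    (φ : 𝓢(E × F, ℂ)) (hφ : ∀ x y, φ (x, y) = φ₁ x * φ₂ y) :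
    tensorProd g₁ g₂ φ = g₁ φ₁ * g₂ φ₂ := by
  have h : partialEvalCLM g₂ φ = g₂ φ₂ • φ₁ := by
    ext x
    have hs : slice x φ = φ₁ x • φ₂ := by ext y; simp [slice_apply, hφ]
    change g₂ (slice x φ) = _
    rw [hs, map_smul]
    simp [mul_comm]
  change g₁ (partialEvalCLM g₂ φ) = _
  rw [h, map_smul, smul_eq_mul, mul_comm]

theorem tensorProd_apply (g₁ : 𝓢'(E, ℂ)) (g₂ : 𝓢'(F, ℂ)) (φ : 𝓢(E × F, ℂ)) :
    tensorProd g₁ g₂ φ = g₁ (partialEvalCLM g₂ φ) := rfl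

theorem partialEvalCLM_apply (g : 𝓢'(F, ℂ)) (φ : 𝓢(E × F, ℂ)) (x : E) :
    partialEvalCLM g φ x = g (slice x φ) := rfl

variable {n k : ℕ}

/-- The identification `ℝⁿ ≃ ℝᵏ × ℝⁿ⁻ᵏ`, `x ↦ ((x₁, …, x_k), (x_{k+1}, …, x_n))`. -/
def splitEquiv (hk : k ≤ n) : EuclideanSpace ℝ (Fin n) ≃L[ℝ]
    EuclideanSpace ℝ (Fin k) × EuclideanSpace ℝ (Fin (n - k)) :=
  (LinearIsometryEquiv.piLpCongrLeft 2 ℝ ℝ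
    (finCongr (Nat.add_sub_cancel' hk).symm)).toContinuousLinearEquiv.trans
      EuclideanSpace.finAddEquivProd

theorem splitEquiv_fst (hk : k ≤ n) (x : EuclideanSpace ℝ (Fin n)) (i : Fin k) :
    (splitEquiv hk x).1 i = x (Fin.castLE hk i) := by
  rfl

theorem splitEquiv_snd (hk : k ≤ n) (x : EuclideanSpace ℝ (Fin n)) (j : Fin (n - k)) :
    (splitEquiv hk x).2 j = x ⟨k + j, by omega⟩ := by
  rfl

/-- The tensor product of distributions on `ℝᵏ` and `ℝⁿ⁻ᵏ`, as a distribution on `ℝⁿ`. -/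
def euclideanTensor (hk : k ≤ n) (g₁ : 𝓢'(EuclideanSpace ℝ (Fin k), ℂ))
    (g₂ : 𝓢'(EuclideanSpace ℝ (Fin (n - k)), ℂ)) : 𝓢'(EuclideanSpace ℝ (Fin n), ℂ) :=
  PointwiseConvergenceCLM.precomp ℂ
    (compCLMOfContinuousLinearEquiv ℂ (splitEquiv hk).symm) (tensorProd g₁ g₂)

/-- The linear bijection `x ↦ Uᵀ x` of `ℝⁿ` for an orthogonal matrix `U`. -/
def transposeEquiv (U : Matrix.orthogonalGroup (Fin n) ℝ) :
    EuclideanSpace ℝ (Fin n) ≃L[ℝ] EuclideanSpace ℝ (Fin n) :=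
  ContinuousLinearEquiv.equivOfInverse
    (Matrix.toEuclideanCLM (𝕜 := ℝ) (U : Matrix (Fin n) (Fin n) ℝ).transpose)
    (Matrix.toEuclideanCLM (𝕜 := ℝ) (U : Matrix (Fin n) (Fin n) ℝ))
    (fun x => by
      have h : (U : Matrix (Fin n) (Fin n) ℝ) * (U : Matrix (Fin n) (Fin n) ℝ).transpose = 1 :=
        (Matrix.mem_orthogonalGroup_iff (Fin n) ℝ).1 U.2
      rw [← mul_apply_eq_comp, ← map_mul, h, map_one]; rfl)
    (fun x => by
      have h : (U : Matrix (Fin n) (Fin n) ℝ).transpose * (U : Matrix (Fin n) (Fin n) ℝ) = 1 :=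
        (Matrix.mem_orthogonalGroup_iff' (Fin n) ℝ).1 U.2
      rw [← mul_apply_eq_comp, ← map_mul, h, map_one]; rfl)

/-- The change of variables `⟨g_U, φ⟩ = ⟨g, φ(Uᵀ ·)⟩`. -/
def changeVar (U : Matrix.orthogonalGroup (Fin n) ℝ) (g : 𝓢'(EuclideanSpace ℝ (Fin n), ℂ)) :
    𝓢'(EuclideanSpace ℝ (Fin n), ℂ) :=
  PointwiseConvergenceCLM.precomp ℂ (compCLMOfContinuousLinearEquiv ℂ (transposeEquiv U)) g

/-- The set of all `(f ⊗ δⁿ⁻ᵏ)_U` with `f ∈ 𝓢'(ℝᵏ)` and `U` an orthogonal `n × n` matrix. -/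
def GPrime (hk : k ≤ n) : Set 𝓢'(EuclideanSpace ℝ (Fin n), ℂ) :=
  {T | ∃ (f : 𝓢'(EuclideanSpace ℝ (Fin k), ℂ)) (U : Matrix.orthogonalGroup (Fin n) ℝ),
    T = changeVar U (euclideanTensor hk f (TemperedDistribution.delta 0))}

/-- The product `x_i T` of a distribution with the `i`-th coordinate function. -/
def coordMul (i : Fin n) (T : 𝓢'(EuclideanSpace ℝ (Fin n), ℂ)) :
    𝓢'(EuclideanSpace ℝ (Fin n), ℂ) :=
  TemperedDistribution.smulLeftCLM ℂ (fun x => ((x i : ℝ) : ℂ)) T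

theorem coord_hasTemperateGrowth (i : Fin n) :
    (fun x : EuclideanSpace ℝ (Fin n) => ((x i : ℝ) : ℂ)).HasTemperateGrowth :=
  (Complex.ofRealCLM.comp
    (EuclideanSpace.proj i : EuclideanSpace ℝ (Fin n) →L[ℝ] ℝ)).hasTemperateGrowth

theorem coordMul_apply (i : Fin n) (T : 𝓢'(EuclideanSpace ℝ (Fin n), ℂ))
    (φ ψ : 𝓢(EuclideanSpace ℝ (Fin n), ℂ)) (hψ : ∀ x, ψ x = (x i : ℂ) * φ x) :
    coordMul i T φ = T ψ := by
  have h : SchwartzMap.smulLeftCLM ℂ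
      (fun x : EuclideanSpace ℝ (Fin n) => ((x i : ℝ) : ℂ)) φ = ψ := by
    ext x
    rw [SchwartzMap.smulLeftCLM_apply_apply (coord_hasTemperateGrowth i), hψ, smul_eq_mul]
  rw [coordMul, TemperedDistribution.smulLeftCLM_apply_apply, h]

end TensorDistribution

end

/-!
After an orthogonal change of variables, `T ∈ 𝒢'ₖ` says that `T = f ⊗ δ`, which holds if and only if
each of the last `n - k` coordinates annihilates `T`. Undoing the rotation, `T ∈ 𝒢'ₖ` if and only if
the kernel of `c ↦ ⟪c, ·⟫T` contains `n - k` orthonormal vectors, i.e. has dimension at least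
`n - k`. The range of this map is the span of the `xᵢT`, so rank–nullity gives the bound `k`.

Suppose that the coordinates `yⱼ` of the second factor annihilate `T`, and let `χ 0 = 1`. Then
`t ↦ ⟨T, φ(x, t y) χ((1 - t) y)⟩` has derivative zero, because the `t`-derivative of the test
function is a sum of multiples of the `yⱼ`. Comparing `t = 1` with `t = 0` gives
`⟨T, φ⟩ = ⟨T, φ(·, 0) ⊗ χ⟩`, hence `T = f ⊗ δ` with `f = ⟨T, · ⊗ χ⟩`.
-/

namespace TensorDistribution

section LinearAlgebra

variable {ι 𝕜 V : Type*} [Fintype ι] [RCLike 𝕜] [NormedAddCommGroup V] [InnerProductSpace 𝕜 V]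
  [FiniteDimensional 𝕜 V]

theorem exists_orthonormal_mem_iff (hι : Module.finrank 𝕜 V = Fintype.card ι) (s : Finset ι)
    (W : Submodule 𝕜 V) :
    (∃ v : ι → V, Orthonormal 𝕜 v ∧ ∀ i ∈ s, v i ∈ W) ↔ s.card ≤ Module.finrank 𝕜 W := by
  constructor
  · rintro ⟨v, hv, hvW⟩
    let w : s → W := fun i => ⟨v i, hvW i i.2⟩
    have hw : LinearIndependent 𝕜 w :=
      .of_comp W.subtype (hv.linearIndependent.comp _ Subtype.val_injective)
    simpa using hw.fintype_card_le_finrank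
  · intro hs
    obtain ⟨g⟩ : Nonempty (s ↪ Fin (Module.finrank 𝕜 W)) :=
      Function.Embedding.nonempty_of_card_le (by simpa using hs)
    let e := stdOrthonormalBasis 𝕜 W
    let v : ι → V := Function.extend (Subtype.val : s → ι) (fun i => (e (g i) : V)) 0
    have hv (i : s) : v i = e (g i) := Subtype.val_injective.extend_apply _ _ i
    have horth : Orthonormal 𝕜 ((s : Set ι).domRestrict v) := by
      rw [show (s : Set ι).domRestrict v = fun i : s => (e (g i) : V) from funext hv]
      exact (e.orthonormal.comp_linearIsometry W.subtypeₗᵢ).comp g g.injective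
    obtain ⟨b, hb⟩ := horth.exists_orthonormalBasis_extension_of_card_eq hι
    refine ⟨b, b.orthonormal, fun i hi => ?_⟩
    rw [hb i hi, hv ⟨i, hi⟩]
    exact (e _).2

theorem mem_orthogonalGroup_iff_orthonormal [DecidableEq ι] {A : Matrix ι ι ℝ} :
    A ∈ Matrix.orthogonalGroup ι ℝ ↔
      Orthonormal ℝ fun i => (WithLp.toLp 2 (A i) : EuclideanSpace ℝ ι) := by
  rw [Matrix.mem_orthogonalGroup_iff, orthonormal_iff_ite, ← Matrix.ext_iff]
  simp [Matrix.mul_apply, Matrix.one_apply, PiLp.inner_apply, mul_comm]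

theorem exists_orthogonalGroup_row_mem_iff [DecidableEq ι] (s : Finset ι)
    (W : Submodule ℝ (EuclideanSpace ℝ ι)) :
    (∃ U : Matrix.orthogonalGroup ι ℝ, ∀ i ∈ s, WithLp.toLp 2 (U.1 i) ∈ W) ↔
      s.card ≤ Module.finrank ℝ W := by
  have hι : Module.finrank ℝ (EuclideanSpace ℝ ι) = Fintype.card ι := finrank_euclideanSpace
  rw [← exists_orthonormal_mem_iff hι]
  constructor
  · rintro ⟨U, hU⟩
    exact ⟨_, mem_orthogonalGroup_iff_orthonormal.1 U.2, hU⟩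
  · rintro ⟨v, hv, hvW⟩
    exact ⟨⟨Matrix.of fun i => (v i).ofLp, mem_orthogonalGroup_iff_orthonormal.2 hv⟩, hvW⟩

end LinearAlgebra

section SchwartzTensor

variable {V E F G : Type*} [NormedAddCommGroup V] [NormedSpace ℝ V]
  [NormedAddCommGroup E] [NormedSpace ℝ E] [NormedAddCommGroup F] [NormedSpace ℝ F]
  [NormedAddCommGroup G] [NormedSpace ℝ G]

theorem hasTemperateGrowth_prod {f : V → E} {g : V → F} (hf : f.HasTemperateGrowth)
    (hg : g.HasTemperateGrowth) : (fun x => (f x, g x)).HasTemperateGrowth := by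
  have h := ((ContinuousLinearMap.inl ℝ E F).hasTemperateGrowth.comp hf).add
    ((ContinuousLinearMap.inr ℝ E F).hasTemperateGrowth.comp hg)
  convert h using 1
  ext x <;> simp

theorem norm_iteratedFDeriv_comp_clm_le {f : E → G} (hf : ContDiff ℝ ∞ f) {L : V →L[ℝ] E}
    (hL : ‖L‖ ≤ 1) (q : ℕ) (z : V) :
    ‖iteratedFDeriv ℝ q (fun w => f (L w)) z‖ ≤ ‖iteratedFDeriv ℝ q f (L z)‖ := by
  change ‖iteratedFDeriv ℝ q (f ∘ L) z‖ ≤ _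
  rw [L.iteratedFDeriv_comp_right hf z (mod_cast le_top)]
  refine (ContinuousMultilinearMap.norm_compContinuousLinearMap_le _ _).trans ?_
  exact mul_le_of_le_one_right (norm_nonneg _)
    (Finset.prod_le_one (fun _ _ => norm_nonneg _) fun _ _ => hL)

theorem one_add_pow_mul_norm_iteratedFDeriv_comp_clm_le (φ : 𝓢(E, ℂ)) {L : V →L[ℝ] E}
    (hL : ‖L‖ ≤ 1) {p q i : ℕ} (hi : i ≤ q) (z : V) :
    (1 + ‖L z‖) ^ p * ‖iteratedFDeriv ℝ i (fun w => φ (L w)) z‖ ≤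
      2 ^ p * (Finset.Iic (p, q)).sup (schwartzSeminormFamily ℂ E ℂ) φ :=
  (mul_le_mul_of_nonneg_left (norm_iteratedFDeriv_comp_clm_le (φ.smooth ⊤) hL i z)
    (by positivity)).trans (one_add_le_sup_seminorm_apply (m := (p, q)) le_rfl hi φ (L z))

theorem pow_mul_norm_iteratedFDeriv_tensor_le (φ : 𝓢(E, ℂ)) (χ : 𝓢(F, ℂ)) (p q : ℕ)
    (z : E × F) :
    ‖z‖ ^ p * ‖iteratedFDeriv ℝ q (fun w : E × F => φ w.1 * χ w.2) z‖ ≤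
      2 ^ q * ((2 ^ p * (Finset.Iic (p, q)).sup (schwartzSeminormFamily ℂ E ℂ) φ) *
        (2 ^ p * (Finset.Iic (p, q)).sup (schwartzSeminormFamily ℂ F ℂ) χ)) := by
  set P := 2 ^ p * (Finset.Iic (p, q)).sup (schwartzSeminormFamily ℂ E ℂ) φ
  set Q := 2 ^ p * (Finset.Iic (p, q)).sup (schwartzSeminormFamily ℂ F ℂ) χ
  have hz : ‖z‖ ^ p ≤ (1 + ‖z.1‖) ^ p * (1 + ‖z.2‖) ^ p := by
    rw [← mul_pow]
    gcongr
    have hmax : ‖z‖ ≤ ‖z.1‖ + ‖z.2‖ := max_le_add_of_nonneg (norm_nonneg _) (norm_nonneg _)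
    nlinarith [norm_nonneg z.1, norm_nonneg z.2]
  have hmul := norm_iteratedFDeriv_mul_le (𝕜 := ℝ) (N := ∞)
    ((φ.smooth ⊤).comp contDiff_fst) ((χ.smooth ⊤).comp contDiff_snd) z (n := q)
    (mod_cast le_top)
  calc _ ≤ ((1 + ‖z.1‖) ^ p * (1 + ‖z.2‖) ^ p) * ∑ i ∈ Finset.range (q + 1), (q.choose i : ℝ) *
        ‖iteratedFDeriv ℝ i (fun w : E × F => φ w.1) z‖ *
        ‖iteratedFDeriv ℝ (q - i) (fun w : E × F => χ w.2) z‖ := by gcongr; exact hmul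
    _ = ∑ i ∈ Finset.range (q + 1), (q.choose i : ℝ) *
        (((1 + ‖z.1‖) ^ p * ‖iteratedFDeriv ℝ i (fun w : E × F => φ w.1) z‖) *
        ((1 + ‖z.2‖) ^ p * ‖iteratedFDeriv ℝ (q - i) (fun w : E × F => χ w.2) z‖)) := by
      rw [Finset.mul_sum]
      exact Finset.sum_congr rfl fun i _ => by ring
    _ ≤ ∑ i ∈ Finset.range (q + 1), (q.choose i : ℝ) * (P * Q) := by
      gcongr with i hi
      · exact one_add_pow_mul_norm_iteratedFDeriv_comp_clm_le φ
          (ContinuousLinearMap.norm_fst_le ℝ E F) (Finset.mem_range_succ_iff.1 hi) z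
      · exact one_add_pow_mul_norm_iteratedFDeriv_comp_clm_le χ
          (ContinuousLinearMap.norm_snd_le ℝ E F) (Nat.sub_le _ _) z
    _ = 2 ^ q * (P * Q) := by
      rw [← Finset.sum_mul, ← Nat.cast_sum, Nat.sum_range_choose]
      push_cast
      rfl

/-- The map `φ ↦ φ ⊗ χ` on Schwartz functions. -/
noncomputable def tensorRight (χ : 𝓢(F, ℂ)) : 𝓢(E, ℂ) →L[ℂ] 𝓢(E × F, ℂ) :=
  mkCLM (fun φ z => φ z.1 * χ z.2) (fun φ ψ z => by simp [add_mul])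
    (fun a φ z => by simp [mul_assoc])
    (fun φ => ((φ.smooth ⊤).comp contDiff_fst).mul ((χ.smooth ⊤).comp contDiff_snd))
    fun (p, q) => ⟨Finset.Iic (p, q),
      2 ^ q * 2 ^ p * (2 ^ p * (Finset.Iic (p, q)).sup (schwartzSeminormFamily ℂ F ℂ) χ),
      by positivity, fun φ z =>
        (pow_mul_norm_iteratedFDeriv_tensor_le φ χ p q z).trans_eq (by ring)⟩

theorem tensorRight_apply (χ : 𝓢(F, ℂ)) (φ : 𝓢(E, ℂ)) (z : E × F) :
    tensorRight χ φ z = φ z.1 * χ z.2 := rfl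

end SchwartzTensor

section Homotopy

variable {E F : Type*} [NormedAddCommGroup E] [NormedAddCommGroup F] [NormedSpace ℝ F]

/-- The map `(t, (x, y)) ↦ (((x, t y), (1 - t) y), t)`, the change of variables in `homotopy`. -/
def splitMap (z : ℝ × (E × F)) : ((E × F) × F) × ℝ :=
  (((z.2.1, z.1 • z.2.2), (1 - z.1) • z.2.2), z.1)

theorem norm_le_splitMap (z : ℝ × (E × F)) : ‖z‖ ≤ 2 * (1 + ‖splitMap z‖) ^ 1 := by
  obtain ⟨t, x, y⟩ := z
  set s := ‖splitMap (t, x, y)‖ with hs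
  simp only [splitMap, Prod.norm_def, max_assoc] at hs
  have hx : ‖x‖ ≤ s := by rw [hs]; simp
  have hy₁ : ‖t • y‖ ≤ s := by rw [hs]; simp
  have hy₂ : ‖(1 - t) • y‖ ≤ s := by rw [hs]; simp
  have ht : ‖t‖ ≤ s := by rw [hs]; simp
  have hy : ‖y‖ ≤ ‖t • y‖ + ‖(1 - t) • y‖ := by
    simpa [← add_smul] using norm_add_le (t • y) ((1 - t) • y)
  have hs₀ : 0 ≤ s := norm_nonneg _
  simp only [Prod.norm_def, pow_one, sup_le_iff]
  refine ⟨?_, ?_, ?_⟩ <;> linarith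

variable [NormedSpace ℝ E]

theorem hasTemperateGrowth_splitMap :
    (splitMap : ℝ × (E × F) → ((E × F) × F) × ℝ).HasTemperateGrowth := by
  have ht : (fun z : ℝ × (E × F) => z.1).HasTemperateGrowth :=
    (ContinuousLinearMap.fst ℝ ℝ (E × F)).hasTemperateGrowth
  have hx : (fun z : ℝ × (E × F) => z.2.1).HasTemperateGrowth :=
    (ContinuousLinearMap.fst ℝ E F ∘L ContinuousLinearMap.snd ℝ ℝ (E × F)).hasTemperateGrowth
  have hy : (fun z : ℝ × (E × F) => z.2.2).HasTemperateGrowth :=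
    (ContinuousLinearMap.snd ℝ E F ∘L ContinuousLinearMap.snd ℝ ℝ (E × F)).hasTemperateGrowth
  have ht' : (fun z : ℝ × (E × F) => 1 - z.1).HasTemperateGrowth := by fun_prop
  exact hasTemperateGrowth_prod
    (hasTemperateGrowth_prod (hasTemperateGrowth_prod hx (ht.smul hy)) (ht'.smul hy)) ht

/-- The Schwartz function `(t, (x, y)) ↦ θ(t) Φ((x, t y), (1 - t) y)`. Splitting `y` into `t y` and
`(1 - t) y` keeps the decay in `y` for all `t`; the cutoff `θ` provides the decay in `t`. -/
noncomputable def homotopy (θ : 𝓢(ℝ, ℂ)) : 𝓢((E × F) × F, ℂ) →L[ℂ] 𝓢(ℝ × (E × F), ℂ) :=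
  compCLM ℂ hasTemperateGrowth_splitMap ⟨1, 2, norm_le_splitMap⟩ ∘L tensorRight θ

theorem homotopy_apply (θ : 𝓢(ℝ, ℂ)) (Φ : 𝓢((E × F) × F, ℂ)) (t : ℝ) (z : E × F) :
    homotopy θ Φ (t, z) = Φ ((z.1, t • z.2), (1 - t) • z.2) * θ t := rfl

theorem lineDeriv_homotopy_apply {θ : 𝓢(ℝ, ℂ)} {t : ℝ} (hθ : ∀ᶠ s in nhds t, θ s = 1)
    (Φ : 𝓢((E × F) × F, ℂ)) (z : E × F) :
    (∂_{((1 : ℝ), (0 : E × F))} (homotopy θ Φ) : 𝓢(ℝ × (E × F), ℂ)) (t, z) =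
      fderiv ℝ Φ ((z.1, t • z.2), (1 - t) • z.2) ((0, z.2), -z.2) := by
  have hleft : HasDerivAt (fun s => homotopy θ Φ (s, z))
      ((∂_{((1 : ℝ), (0 : E × F))} (homotopy θ Φ) : 𝓢(ℝ × (E × F), ℂ)) (t, z)) t := by
    rw [lineDerivOp_apply_eq_fderiv]
    exact (homotopy θ Φ).differentiableAt.hasFDerivAt.comp_hasDerivAt t
      ((hasDerivAt_id t).prodMk (hasDerivAt_const t z))
  have hy₁ : HasDerivAt (fun s : ℝ => s • z.2) z.2 t := by
    simpa using (hasDerivAt_id t).smul_const z.2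
  have hy₂ : HasDerivAt (fun s : ℝ => (1 - s) • z.2) (-z.2) t := by
    simpa using ((hasDerivAt_id t).const_sub 1).smul_const z.2
  have hright : HasDerivAt (fun s => Φ ((z.1, s • z.2), (1 - s) • z.2))
      (fderiv ℝ Φ ((z.1, t • z.2), (1 - t) • z.2) ((0, z.2), -z.2)) t :=
    (Φ.differentiableAt (x := ((z.1, t • z.2), (1 - t) • z.2))).hasFDerivAt.comp_hasDerivAt t
      (((hasDerivAt_const t z.1).prodMk hy₁).prodMk hy₂)
  refine hleft.unique (hright.congr_of_eventuallyEq ?_)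
  filter_upwards [hθ] with s hs
  rw [homotopy_apply, hs, mul_one]

theorem exists_schwartz_eq_one_on_ball (F : Type*) [NormedAddCommGroup F] [NormedSpace ℝ F]
    [FiniteDimensional ℝ F] {r : ℝ} (hr : 0 < r) :
    ∃ χ : 𝓢(F, ℂ), ∀ y ∈ Metric.ball (0 : F) r, χ y = 1 := by
  let b : ContDiffBump (0 : F) := ⟨r, r + 1, hr, lt_add_one r⟩
  have hsupp : HasCompactSupport fun y => (b y : ℂ) :=
    b.hasCompactSupport.comp_left Complex.ofReal_zero
  have hsmooth : ContDiff ℝ ∞ fun y => (b y : ℂ) := Complex.ofRealCLM.contDiff.comp b.contDiff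
  refine ⟨hsupp.toSchwartzMap hsmooth, fun y hy => ?_⟩
  simp [b.one_of_mem_closedBall (Metric.ball_subset_closedBall hy)]

end Homotopy

noncomputable section Pushforward

variable {V W : Type*} [NormedAddCommGroup V] [NormedSpace ℝ V] [NormedAddCommGroup W]
  [NormedSpace ℝ W]

/-- The pushforward `⟨A_* T, φ⟩ = ⟨T, φ ∘ A⟩` of a tempered distribution under a linear
isomorphism; both `changeVar` and the passage from `ℝᵏ × ℝⁿ⁻ᵏ` to `ℝⁿ` are instances. -/
def pushforward (A : V ≃L[ℝ] W) : 𝓢'(V, ℂ) →L[ℂ] 𝓢'(W, ℂ) :=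
  PointwiseConvergenceCLM.precomp ℂ (compCLMOfContinuousLinearEquiv ℂ A)

/-- The product `ℓT` of a tempered distribution with a linear form, as a linear map in `ℓ`; its
kernel consists of the forms that annihilate `T`. -/
def dualMul (T : 𝓢'(V, ℂ)) : StrongDual ℝ V →ₗ[ℝ] 𝓢'(V, ℂ) where
  toFun ℓ := TemperedDistribution.smulLeftCLM ℂ (fun x => (ℓ x : ℂ)) T
  map_add' ℓ m := by
    rw [← add_apply, ← TemperedDistribution.smulLeftCLM_add (by fun_prop) (by fun_prop)]
    congr! 3
    simp
  map_smul' c ℓ := by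
    rw [RingHom.id_apply, ← Complex.coe_smul, ← smul_apply,
      ← TemperedDistribution.smulLeftCLM_smul (by fun_prop)]
    congr! 3
    simp

theorem pushforward_pushforward_symm (A : V ≃L[ℝ] W) (T : 𝓢'(W, ℂ)) :
    pushforward A (pushforward A.symm T) = T := by
  ext φ
  exact congrArg T (SchwartzMap.ext fun x => congrArg φ (A.apply_symm_apply x))

theorem eq_pushforward_iff {A : V ≃L[ℝ] W} {S : 𝓢'(V, ℂ)} {T : 𝓢'(W, ℂ)} :
    T = pushforward A S ↔ pushforward A.symm T = S :=
  ⟨fun h => h ▸ pushforward_pushforward_symm A.symm S,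
    fun h => h ▸ (pushforward_pushforward_symm A T).symm⟩

theorem dualMul_apply (T : 𝓢'(V, ℂ)) (ℓ : StrongDual ℝ V) (φ : 𝓢(V, ℂ)) :
    dualMul T ℓ φ = T (SchwartzMap.smulLeftCLM ℂ (fun x => (ℓ x : ℂ)) φ) := rfl

theorem smulLeftCLM_dual_apply (ℓ : StrongDual ℝ V) (φ : 𝓢(V, ℂ)) (x : V) :
    SchwartzMap.smulLeftCLM ℂ (fun x => (ℓ x : ℂ)) φ x = ℓ x * φ x :=
  SchwartzMap.smulLeftCLM_apply_apply (by fun_prop) φ x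

theorem dualMul_pushforward (A : V ≃L[ℝ] W) (T : 𝓢'(V, ℂ)) (ℓ : StrongDual ℝ W) :
    dualMul (pushforward A T) ℓ = pushforward A (dualMul T (ℓ ∘L A)) := by
  ext φ
  refine congrArg T (SchwartzMap.ext fun x => ?_)
  trans (ℓ (A x) : ℂ) * φ (A x)
  · exact smulLeftCLM_dual_apply ℓ φ (A x)
  · exact (smulLeftCLM_dual_apply (ℓ ∘L A) (compCLMOfContinuousLinearEquiv ℂ A φ) x).symm

theorem dualMul_pushforward_eq_zero_iff {A : V ≃L[ℝ] W} {T : 𝓢'(V, ℂ)} {ℓ : StrongDual ℝ W} :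
    dualMul (pushforward A T) ℓ = 0 ↔ dualMul T (ℓ ∘L A) = 0 := by
  rw [dualMul_pushforward, eq_comm, eq_pushforward_iff, map_zero, eq_comm]

end Pushforward

section Division

variable {ι E F : Type*} [NormedAddCommGroup E] [NormedSpace ℝ E]
  [NormedAddCommGroup F] [NormedSpace ℝ F] [FiniteDimensional ℝ F]

/-- The linear form on `E × F` that reads off the `i`-th coordinate of the second factor. -/
noncomputable def sndCoord (b : Module.Basis ι ℝ F) (i : ι) : StrongDual ℝ (E × F) :=
  (b.coord i).toContinuousLinearMap ∘L ContinuousLinearMap.snd ℝ E F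

theorem sndCoord_apply (b : Module.Basis ι ℝ F) (i : ι) (z : E × F) :
    sndCoord b i z = b.repr z.2 i := rfl

theorem slice_lineDeriv_homotopy [Fintype ι] {θ : 𝓢(ℝ, ℂ)} {t : ℝ} (hθ : ∀ᶠ s in nhds t, θ s = 1)
    (Φ : 𝓢((E × F) × F, ℂ)) (b : Module.Basis ι ℝ F) :
    slice t (∂_{((1 : ℝ), (0 : E × F))} (homotopy θ Φ)) =
      ∑ i, SchwartzMap.smulLeftCLM ℂ (fun z => (sndCoord b i z : ℂ))
        (slice t (homotopy θ (∂_{(((0 : E), b i), -b i)} Φ))) := by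
  ext z
  have hz : (((0 : E), z.2), -z.2) = ∑ i, b.repr z.2 i • (((0 : E), b i), -b i) := by
    simp [Prod.ext_iff, Prod.fst_sum, Prod.snd_sum, b.sum_repr]
  rw [slice_apply, lineDeriv_homotopy_apply hθ, hz, map_sum, sum_apply]
  refine Finset.sum_congr rfl fun i _ => ?_
  rw [smulLeftCLM_dual_apply, sndCoord_apply, slice_apply, homotopy_apply, hθ.self_of_nhds,
    lineDerivOp_apply_eq_fderiv, map_smul, mul_one, Complex.real_smul]

theorem hasDerivAt_partialEval_homotopy {T : 𝓢'(E × F, ℂ)} (b : Module.Basis ι ℝ F)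
    (hT : ∀ i, dualMul T (sndCoord b i) = 0) {θ : 𝓢(ℝ, ℂ)} {t : ℝ}
    (hθ : ∀ᶠ s in nhds t, θ s = 1) (Φ : 𝓢((E × F) × F, ℂ)) :
    HasDerivAt (partialEval T (homotopy θ Φ)) 0 t := by
  have := Module.Finite.finite_basis b
  cases nonempty_fintype ι
  obtain ⟨L, hL, hL'⟩ := hasFDerivAt_partialEval T (homotopy θ Φ) t
  have hzero : L 1 = 0 := by
    rw [hL', partialEval, slice_lineDeriv_homotopy hθ Φ b, map_sum]
    exact Finset.sum_eq_zero fun i _ => by rw [← dualMul_apply, hT, zero_apply]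
  exact hzero ▸ hL.hasDerivAt

variable [FiniteDimensional ℝ E]

theorem apply_eq_apply_tensorRight {T : 𝓢'(E × F, ℂ)} (b : Module.Basis ι ℝ F)
    (hT : ∀ i, dualMul T (sndCoord b i) = 0) {χ : 𝓢(F, ℂ)} (hχ : χ 0 = 1) (φ : 𝓢(E × F, ℂ)) :
    T φ = T (tensorRight χ (partialEvalCLM (TemperedDistribution.delta 0) φ)) := by
  obtain ⟨θ, hθ⟩ := exists_schwartz_eq_one_on_ball ℝ two_pos
  set Ψ := homotopy θ (tensorRight χ φ) with hΨ
  have hderiv {t : ℝ} (ht : t ∈ Metric.ball (0 : ℝ) 2) : HasDerivAt (partialEval T Ψ) 0 t :=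
    hasDerivAt_partialEval_homotopy b hT
      (Filter.eventually_of_mem (Metric.isOpen_ball.mem_nhds ht) hθ) _
  have h0 : (0 : ℝ) ∈ Metric.ball (0 : ℝ) 2 := by simp
  have h1 : (1 : ℝ) ∈ Metric.ball (0 : ℝ) 2 := by simp
  have hconst : partialEval T Ψ 1 = partialEval T Ψ 0 :=
    Metric.isOpen_ball.is_const_of_deriv_eq_zero (convex_ball (0 : ℝ) 2).isPreconnected
      (fun t ht => (hderiv ht).differentiableAt.differentiableWithinAt)
      (fun t ht => (hderiv ht).deriv) h1 h0
  have hΨ1 : slice 1 Ψ = φ := by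
    ext z
    simp [slice_apply, hΨ, homotopy_apply, tensorRight_apply, hθ 1 h1, hχ]
  have hΨ0 : slice 0 Ψ = tensorRight χ (partialEvalCLM (TemperedDistribution.delta 0) φ) := by
    ext z
    simp [slice_apply, hΨ, homotopy_apply, tensorRight_apply, hθ 0 h0, partialEvalCLM_apply]
  simpa only [partialEval, hΨ1, hΨ0] using hconst

theorem exists_eq_tensorProd_delta_iff {T : 𝓢'(E × F, ℂ)} (b : Module.Basis ι ℝ F) :
    (∃ f : 𝓢'(E, ℂ), T = tensorProd f (TemperedDistribution.delta 0)) ↔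
      ∀ i, dualMul T (sndCoord b i) = 0 := by
  constructor
  · rintro ⟨f, rfl⟩ i
    ext φ
    rw [dualMul_apply, tensorProd_apply, zero_apply]
    convert map_zero f
    ext x
    rw [partialEvalCLM_apply, TemperedDistribution.delta_apply, slice_apply,
      smulLeftCLM_dual_apply, sndCoord_apply]
    simp
  · intro hT
    obtain ⟨χ, hχ⟩ := exists_schwartz_eq_one_on_ball F one_pos
    refine ⟨PointwiseConvergenceCLM.precomp ℂ (tensorRight χ) T, ?_⟩
    ext φ
    exact apply_eq_apply_tensorRight b hT (hχ 0 (Metric.mem_ball_self one_pos)) φ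

end Division

noncomputable section Coordinates

variable {H : Type*} [NormedAddCommGroup H] [InnerProductSpace ℝ H] {n k : ℕ}

/-- The product `⟪c, ·⟫T`, as a linear map in the coefficient vector `c`. -/
def innerMul (T : 𝓢'(H, ℂ)) : H →ₗ[ℝ] 𝓢'(H, ℂ) where
  toFun c := dualMul T (innerSL ℝ c)
  map_add' c d := by simp
  map_smul' r c := by simp

theorem innerMul_apply (T : 𝓢'(H, ℂ)) (c : H) : innerMul T c = dualMul T (innerSL ℝ c) := rfl

theorem range_innerMul (T : 𝓢'(EuclideanSpace ℝ (Fin n), ℂ)) :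
    LinearMap.range (innerMul T) = Submodule.span ℝ (Set.range fun i => coordMul i T) := by
  have hcoord (i : Fin n) : innerMul T (EuclideanSpace.basisFun (Fin n) ℝ i) = coordMul i T := by
    simp only [innerMul_apply, dualMul, LinearMap.coe_mk, AddHom.coe_mk, coordMul]
    simp [EuclideanSpace.inner_single_left]
  rw [LinearMap.range_eq_map, ← (EuclideanSpace.basisFun (Fin n) ℝ).toBasis.span_eq,
    Submodule.map_span, ← Set.range_comp]
  simp only [Function.comp_def, OrthonormalBasis.coe_toBasis, hcoord]

theorem changeVar_euclideanTensor_eq (hk : k ≤ n) (U : Matrix.orthogonalGroup (Fin n) ℝ)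
    (g₁ : 𝓢'(EuclideanSpace ℝ (Fin k), ℂ)) (g₂ : 𝓢'(EuclideanSpace ℝ (Fin (n - k)), ℂ)) :
    changeVar U (euclideanTensor hk g₁ g₂) =
      pushforward ((splitEquiv hk).symm.trans (transposeEquiv U)) (tensorProd g₁ g₂) := rfl

/-- The position `k + j` in `ℝⁿ` of the `j`-th coordinate of the factor `ℝⁿ⁻ᵏ`. -/
def tailEmbedding (hk : k ≤ n) : Fin (n - k) ↪ Fin n :=
  (Fin.natAddEmb k).trans (finCongr (Nat.add_sub_cancel' hk)).toEmbedding

theorem sndCoord_comp_splitEquiv_comp_transposeEquiv_symm (hk : k ≤ n)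
    (U : Matrix.orthogonalGroup (Fin n) ℝ) (j : Fin (n - k)) :
    sndCoord (EuclideanSpace.basisFun (Fin (n - k)) ℝ).toBasis j ∘L
      ((splitEquiv hk).symm.trans (transposeEquiv U)).symm.toContinuousLinearMap =
      innerSL ℝ (WithLp.toLp 2 (U.1 (tailEmbedding hk j))) := by
  ext x
  change (U.1.mulVec x) (tailEmbedding hk j) = _
  simp [Matrix.mulVec, dotProduct, PiLp.inner_apply, mul_comm]

theorem mem_GPrime_iff (hk : k ≤ n) {T : 𝓢'(EuclideanSpace ℝ (Fin n), ℂ)} :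
    T ∈ GPrime hk ↔ ∃ U : Matrix.orthogonalGroup (Fin n) ℝ, ∀ j : Fin (n - k),
      WithLp.toLp 2 (U.1 (tailEmbedding hk j)) ∈ LinearMap.ker (innerMul T) := by
  change (∃ f U, T = changeVar U (euclideanTensor hk f (TemperedDistribution.delta 0))) ↔ _
  rw [exists_comm]
  refine exists_congr fun U => ?_
  simp only [changeVar_euclideanTensor_eq, eq_pushforward_iff,
    exists_eq_tensorProd_delta_iff (EuclideanSpace.basisFun (Fin (n - k)) ℝ).toBasis,
    dualMul_pushforward_eq_zero_iff, LinearMap.mem_ker, innerMul_apply,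
    sndCoord_comp_splitEquiv_comp_transposeEquiv_symm]

end Coordinates

end TensorDistribution

open TensorDistribution

theorem theorem2 (n k : ℕ) (hk : k ≤ n) (T : 𝓢'(EuclideanSpace ℝ (Fin n), ℂ)) :
    T ∈ TensorDistribution.GPrime hk ↔
      Module.finrank ℝ (Submodule.span ℝ
        (Set.range fun i : Fin n => TensorDistribution.coordMul i T)) ≤ k := by
  have hrank := (innerMul T).finrank_range_add_finrank_ker
  rw [finrank_euclideanSpace_fin] at hrank
  calc T ∈ GPrime hk
      ↔ ∃ U : Matrix.orthogonalGroup (Fin n) ℝ, ∀ l ∈ Finset.univ.map (tailEmbedding hk),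
          WithLp.toLp 2 (U.1 l) ∈ LinearMap.ker (innerMul T) := by
        simp only [mem_GPrime_iff, Finset.forall_mem_map, Finset.mem_univ, forall_const]
    _ ↔ n - k ≤ Module.finrank ℝ (LinearMap.ker (innerMul T)) := by
        rw [exists_orthogonalGroup_row_mem_iff, Finset.card_map, Finset.card_fin]
    _ ↔ Module.finrank ℝ (LinearMap.range (innerMul T)) ≤ k := by omega
    _ ↔ _ := by rw [range_innerMul]
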